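/- Let $d\ge 0$ and $M\ge 2$ be fixed integers, $t\in\mathbb{R}$, and let $s:\mathbb{R}^d\times\mathbb{R}^d\to\mathbb{R}$ be a measurable symmetric function. For identities $i=1,2,\dots$ and instances $k=1,\dots,M$ let $X_{(i,k)}$ be random vectors in $\mathbb{R}^d$ on a common probability space, all with the same law $Q$, such that the families $(X_{(i,1)},\dots,X_{(i,M)})$, $i\ge 1$, are independent and identically distributed (embeddings of the same identity may be dependent). Put $Y_{(i,k),(i,l)}=\mathbb{1}\{s(X_{(i,k)},X_{(i,l)})\ge t\}$ for $k\neq l$ and $Y_{(i,k),(j,l)}=\mathbb{1}\{s(X_{(i,k)},X_{(j,l)})<t\}$ for $i\ne j$, and suppose that $Y_{(i,k),(i,l)}\sim\mathrm{Bernoulli}(\mathrm{FRR})$ for all $i$ and all $k\neq l$, and $Y_{(i,k),(j,l)}\sim\mathrm{Bernoulli}(\mathrm{FAR})$ for all $i\ne j$ and all $k,l$. Let $$\bar Y_{ii}=\frac{1}{M(M-1)}\sum_{k=1}^M\sum_{l\ne k}Y_{(i,k),(i,l)},\qquad \bar Y_{ij}=\frac1{M^2}\sum_{k,l=1}^M Y_{(i,k),(j,l)}\quad(i\neq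 j),$$ $$\widehat{\mathrm{FRR}}=\frac1G\sum_{i=1}^G\bar Y_{ii},\qquad \widehat{\mathrm{FAR}}=\frac1{G(G-1)}\sum_{i=1}^G\sum_{\substack{j=1\\ j\ne i}}^G\bar Y_{ij}.$$ Assume that $\lim_{G\to\infty}\mathrm{Var}(\sqrt G\,\widehat{\mathrm{FRR}})=c_{\mathrm{FRR}}$ and $\lim_{G\to\infty}\mathrm{Var}(\sqrt G\,\widehat{\mathrm{FAR}})=c_{\mathrm{FAR}}$ for some positive constants $c_{\mathrm{FRR}},c_{\mathrm{FAR}}$. Then, as $G\to\infty$ with $M$ fixed, $$\sqrt G(\widehat{\mathrm{FRR}}-\mathrm{FRR})\xrightarrow{d}\mathcal N\bigl(0,\mathrm{Var}(\bar Y_{11})\bigr)\quad\text{and}\quad \sqrt G(\widehat{\mathrm{FAR}}-\mathrm{FAR})\xrightarrow{d}\mathcal N\bigl(0,4\,\mathrm{Cov}(\bar Y_{12},\bar Y_{13})\bigr).$$ -/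

import Mathlib

open MeasureTheory ProbabilityTheory Filter
open scoped NNReal

noncomputable section

namespace FaceVerification

variable {Ω : Type*} {d M : ℕ}

/-- The error indicator of the comparison of instance `k` of identity `i` with instance `l` of
identity `j`: for `i = j` it is `1` exactly if `s ≥ t` (false rejection), for `i ≠ j` it is `1`
exactly if `s < t` (false acceptance). -/
def Y (s : EuclideanSpace ℝ (Fin d) → EuclideanSpace ℝ (Fin d) → ℝ) (t : ℝ)
    (X : ℕ → Fin M → Ω → EuclideanSpace ℝ (Fin d))
    (i : ℕ) (k : Fin M) (j : ℕ) (l : Fin M) (ω : Ω) : ℝ :=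
  open Classical in
  if i = j then (if t ≤ s (X i k ω) (X j l ω) then 1 else 0)
  else (if s (X i k ω) (X j l ω) < t then 1 else 0)

/-- The identity-level averages: over ordered pairs of distinct instances when `i = j`, over all
pairs of instances when `i ≠ j`. -/
def Ybar (s : EuclideanSpace ℝ (Fin d) → EuclideanSpace ℝ (Fin d) → ℝ) (t : ℝ)
    (X : ℕ → Fin M → Ω → EuclideanSpace ℝ (Fin d)) (i j : ℕ) (ω : Ω) : ℝ :=
  if i = j then
    ∑ k : Fin M, ∑ l ∈ Finset.univ.filter (fun l : Fin M => l ≠ k),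
      Y s t X i k i l ω / ((M : ℝ) * ((M : ℝ) - 1))
  else
    ∑ k : Fin M, ∑ l : Fin M, Y s t X i k j l ω / (M : ℝ) ^ 2

/-- The estimator of the false rejection rate from the first `G` identities. -/
def FRRhat (s : EuclideanSpace ℝ (Fin d) → EuclideanSpace ℝ (Fin d) → ℝ) (t : ℝ)
    (X : ℕ → Fin M → Ω → EuclideanSpace ℝ (Fin d)) (G : ℕ) (ω : Ω) : ℝ :=
  ∑ i ∈ Finset.range G, Ybar s t X i i ω / (G : ℝ)

/-- The estimator of the false acceptance rate from the first `G` identities. -/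
def FARhat (s : EuclideanSpace ℝ (Fin d) → EuclideanSpace ℝ (Fin d) → ℝ) (t : ℝ)
    (X : ℕ → Fin M → Ω → EuclideanSpace ℝ (Fin d)) (G : ℕ) (ω : Ω) : ℝ :=
  ∑ i ∈ Finset.range G, ∑ j ∈ (Finset.range G).filter (fun j => j ≠ i),
    Ybar s t X i j ω / ((G : ℝ) * ((G : ℝ) - 1))

end FaceVerification

end

/-! ### Second-order U-statistics with bounded symmetric kernels -/

namespace UStatistic

variable {Ω E F : Type*} [MeasurableSpace Ω] [MeasurableSpace E] [MeasurableSpace F]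
  {P : Measure Ω}

/-! Let `Z i` be the whole family of embeddings of identity `i`; dependence inside a family then
plays no role. The FRR estimator is a mean of i.i.d. bounded variables, so the classical CLT
applies. The FAR estimator is a U-statistic with kernel `h`. Put `g x = E h(x, Z 0)` and `θ = E h(Z
0, Z 1)`. Hoeffding's decomposition `h x y = g x + g y - θ + r x y` leaves a remainder that
integrates to zero in each argument. Hence `r` at two index pairs is uncorrelated unless the pairs
agree up to order, and the `√n`-scaled average of `r` is `O(n ^ (-1/2))` in `L²`
(`tendsto_eLpNorm_degenerate`). The linear part is a CLT for `2 g(Z i)`, with variance `4 Var g(Z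
0)`, and conditioning on the shared argument identifies `Var g(Z 0)` with the stated covariance
(`covariance_kernel_eq_variance`). -/

lemma indepFun_triple {Z : ℕ → Ω → E} (hZ : ∀ i, Measurable (Z i)) (hindep : iIndepFun Z P)
    {i k l j : ℕ} (hi : i ≠ j) (hk : k ≠ j) (hl : l ≠ j) :
    IndepFun (fun ω => (Z i ω, Z k ω, Z l ω)) (Z j) P := by
  -- Working with the finset of indices allows coincidences among `i`, `k`, `l`.
  have h := hindep.indepFun_finset {i, k, l} {j} (by simp [hi.symm, hk.symm, hl.symm]) hZ
  exact h.comp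
    (φ := fun x : (({i, k, l} : Finset ℕ) → E) =>
      (x ⟨i, by simp⟩, x ⟨k, by simp⟩, x ⟨l, by simp⟩))
    (ψ := fun x : (({j} : Finset ℕ) → E) => x ⟨j, by simp⟩) (by fun_prop) (by fun_prop)

variable [IsProbabilityMeasure P]

/-- Fubini for a bounded function of two independent random variables. -/
lemma integral_comp_prodMk_of_indepFun {V : Ω → F} {W : Ω → E} (hV : Measurable V)
    (hW : Measurable W) (hVW : IndepFun V W P) {f : F × E → ℝ} (hf : Measurable f) {C : ℝ}
    (hfC : ∀ p, |f p| ≤ C) :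
    ∫ ω, f (V ω, W ω) ∂P = ∫ ω, (∫ y, f (V ω, y) ∂(P.map W)) ∂P := by
  have := Measure.isProbabilityMeasure_map (μ := P) hV.aemeasurable
  have := Measure.isProbabilityMeasure_map (μ := P) hW.aemeasurable
  have hint : Integrable f ((P.map V).prod (P.map W)) :=
    Integrable.of_bound hf.aestronglyMeasurable C (Eventually.of_forall hfC)
  rw [← integral_map (f := f) (hV.prodMk hW).aemeasurable hf.aestronglyMeasurable,
    (indepFun_iff_map_prod_eq_prod_map_map hV.aemeasurable hW.aemeasurable).1 hVW,
    integral_prod f hint,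
    integral_map hV.aemeasurable hint.integral_prod_left.aestronglyMeasurable]

/-- Products of a degenerate kernel over two index pairs are uncorrelated unless the pairs agree
up to order. -/
lemma integral_degenerate_mul_eq_zero {Z : ℕ → Ω → E} (hZ : ∀ i, Measurable (Z i))
    (hindep : iIndepFun Z P) (hident : ∀ i, IdentDistrib (Z i) (Z 0) P P)
    {r : E → E → ℝ} (hr : Measurable (Function.uncurry r)) (hsymm : ∀ x y, r x y = r y x)
    {C : ℝ} (hC : ∀ x y, |r x y| ≤ C) (hdeg : ∀ x, ∫ y, r x y ∂(P.map (Z 0)) = 0)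
    {p q : ℕ × ℕ} (hp : p.1 ≠ p.2) (hpq : q ≠ p) (hpq' : q ≠ p.swap) (hq : q.1 ≠ q.2) :
    ∫ ω, r (Z p.1 ω) (Z p.2 ω) * r (Z q.1 ω) (Z q.2 ω) ∂P = 0 := by
  -- If `j` occurs only once, integrating over `Z j` first kills the product by degeneracy.
  have key : ∀ i j k l : ℕ, i ≠ j → k ≠ j → l ≠ j →
      ∫ ω, r (Z i ω) (Z j ω) * r (Z k ω) (Z l ω) ∂P = 0 := by
    intro i j k l hi hk hl
    have hm : Measurable fun p : (E × E × E) × E => r p.1.1 p.2 * r p.1.2.1 p.1.2.2 := by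
      have h1 : Measurable fun p : (E × E × E) × E => r p.1.1 p.2 :=
        hr.comp (g := Function.uncurry r) (f := fun p : (E × E × E) × E => (p.1.1, p.2))
          (by fun_prop)
      have h2 : Measurable fun p : (E × E × E) × E => r p.1.2.1 p.1.2.2 :=
        hr.comp (g := Function.uncurry r) (f := fun p : (E × E × E) × E => (p.1.2.1, p.1.2.2))
          (by fun_prop)
      exact h1.mul h2
    have h := integral_comp_prodMk_of_indepFun ((hZ i).prodMk ((hZ k).prodMk (hZ l))) (hZ j)
      (indepFun_triple hZ hindep hi hk hl) hm (C := C * C) (fun p => by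
        rw [abs_mul]
        exact mul_le_mul (hC _ _) (hC _ _) (abs_nonneg _) ((abs_nonneg _).trans (hC p.1.1 p.2)))
    simp only at h
    rw [h]
    simp [integral_mul_const, (hident j).map_eq, hdeg]
  obtain ⟨i, j⟩ := p
  obtain ⟨k, l⟩ := q
  simp only [ne_eq, Prod.mk.injEq, Prod.swap_prod_mk] at hp hpq hpq' hq ⊢
  -- If `q` contains `j`, it cannot also contain `i`, so by symmetry `i` is the index to integrate
  -- out.
  by_cases hj : k ≠ j ∧ l ≠ j
  · exact key i j k l hp hj.1 hj.2
  · simp_rw [hsymm (Z i _) (Z j _)]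
    exact key j i k l (Ne.symm hp) (by grind) (by grind)

lemma measurable_kernel_comp {Z : ℕ → Ω → E} (hZ : ∀ i, Measurable (Z i))
    {h : E → E → ℝ} (hh : Measurable (Function.uncurry h)) (i j : ℕ) :
    Measurable fun ω => h (Z i ω) (Z j ω) :=
  hh.comp ((hZ i).prodMk (hZ j))

lemma card_offDiag_range (n : ℕ) : ((Finset.range n).offDiag.card : ℝ) = n * (n - 1) := by
  rw [Finset.offDiag_card, Finset.card_range, Nat.cast_sub (Nat.le_mul_self n)]
  push_cast
  ring

/-- Second moment of the sum of a degenerate kernel over ordered pairs of distinct indices. -/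
lemma integral_sq_sum_degenerate_le {Z : ℕ → Ω → E} (hZ : ∀ i, Measurable (Z i))
    (hindep : iIndepFun Z P) (hident : ∀ i, IdentDistrib (Z i) (Z 0) P P)
    {r : E → E → ℝ} (hr : Measurable (Function.uncurry r)) (hsymm : ∀ x y, r x y = r y x)
    {C : ℝ} (hC : ∀ x y, |r x y| ≤ C) (hdeg : ∀ x, ∫ y, r x y ∂(P.map (Z 0)) = 0) (n : ℕ) :
    ∫ ω, (∑ p ∈ (Finset.range n).offDiag, r (Z p.1 ω) (Z p.2 ω)) ^ 2 ∂P ≤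
      (n * (n - 1)) * (2 * C ^ 2) := by
  have hbd : ∀ (p q : ℕ × ℕ) ω,
      |r (Z p.1 ω) (Z p.2 ω) * r (Z q.1 ω) (Z q.2 ω)| ≤ C ^ 2 := fun p q ω => by
    rw [abs_mul, sq]
    exact mul_le_mul (hC _ _) (hC _ _) (abs_nonneg _)
      ((abs_nonneg _).trans (hC (Z p.1 ω) (Z p.2 ω)))
  have hint : ∀ p q : ℕ × ℕ,
      Integrable (fun ω => r (Z p.1 ω) (Z p.2 ω) * r (Z q.1 ω) (Z q.2 ω)) P := fun p q =>
    Integrable.of_bound ((measurable_kernel_comp hZ hr _ _).mul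
      (measurable_kernel_comp hZ hr _ _)).aestronglyMeasurable (C ^ 2)
      (Eventually.of_forall (hbd p q))
  simp_rw [sq (Finset.sum _ _), Finset.sum_mul_sum]
  rw [integral_finsetSum _ fun p _ => integrable_finsetSum _ fun q _ => hint p q]
  rw [← card_offDiag_range, ← nsmul_eq_mul]
  refine Finset.sum_le_card_nsmul _ _ _ fun p hp => ?_
  rw [integral_finsetSum _ fun q _ => hint p q]
  -- For fixed `p` only `q = p` and `q = p.swap` survive, whence the factor `2`.
  have hle : ∀ q ∈ (Finset.range n).offDiag,
      ∫ ω, r (Z p.1 ω) (Z p.2 ω) * r (Z q.1 ω) (Z q.2 ω) ∂P ≤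
        if q ∈ ({p, p.swap} : Finset (ℕ × ℕ)) then C ^ 2 else 0 := by
    intro q hq
    split_ifs with hmem
    · calc _ ≤ ∫ _, C ^ 2 ∂P :=
            integral_mono (hint p q) (integrable_const _) fun ω => (le_abs_self _).trans (hbd p q ω)
        _ = C ^ 2 := by simp
    · simp only [Finset.mem_insert, Finset.mem_singleton, not_or] at hmem
      exact (integral_degenerate_mul_eq_zero hZ hindep hident hr hsymm hC hdeg
        (Finset.mem_offDiag.1 hp).2.2 hmem.1 hmem.2 (Finset.mem_offDiag.1 hq).2.2).le
  refine (Finset.sum_le_sum hle).trans ?_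
  rw [← Finset.sum_filter, Finset.sum_const, nsmul_eq_mul]
  refine mul_le_mul_of_nonneg_right ?_ (sq_nonneg C)
  have h1 : ((Finset.range n).offDiag.filter (· ∈ ({p, p.swap} : Finset (ℕ × ℕ)))).card ≤ 2 :=
    (Finset.card_le_card (t := {p, p.swap}) fun q hq => (Finset.mem_filter.1 hq).2).trans
      Finset.card_le_two
  exact_mod_cast h1

/-- The normalized sum of a degenerate kernel is negligible at the scale `√n`. -/
lemma tendsto_eLpNorm_degenerate {Z : ℕ → Ω → E} (hZ : ∀ i, Measurable (Z i))
    (hindep : iIndepFun Z P) (hident : ∀ i, IdentDistrib (Z i) (Z 0) P P)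
    {r : E → E → ℝ} (hr : Measurable (Function.uncurry r)) (hsymm : ∀ x y, r x y = r y x)
    {C : ℝ} (hC : ∀ x y, |r x y| ≤ C) (hdeg : ∀ x, ∫ y, r x y ∂(P.map (Z 0)) = 0) :
    Tendsto (fun n : ℕ => eLpNorm (fun ω => √(n : ℝ) / (n * (n - 1)) *
      ∑ p ∈ (Finset.range n).offDiag, r (Z p.1 ω) (Z p.2 ω)) 2 P) atTop (nhds 0) := by
  have hlim : Tendsto (fun n : ℕ => ENNReal.ofReal (√(2 * C ^ 2 / ((n : ℝ) - 1)))) atTop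
      (nhds 0) := by
    have h1 : Tendsto (fun n : ℕ => (n : ℝ) - 1) atTop atTop :=
      tendsto_atTop_add_const_right _ _ tendsto_natCast_atTop_atTop
    have h2 := (Real.continuous_sqrt.tendsto 0).comp (h1.const_div_atTop (2 * C ^ 2))
    simpa using ENNReal.tendsto_ofReal h2
  refine tendsto_of_tendsto_of_tendsto_of_le_of_le' tendsto_const_nhds hlim
    (Eventually.of_forall fun _ => zero_le) ?_
  filter_upwards [eventually_ge_atTop 2] with n hn
  have hn' : (2 : ℝ) ≤ n := by exact_mod_cast hn
  have hsum : MemLp (fun ω => ∑ p ∈ (Finset.range n).offDiag, r (Z p.1 ω) (Z p.2 ω)) 2 P :=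
    memLp_finsetSum _ fun p _ =>
      MemLp.of_bound (measurable_kernel_comp hZ hr p.1 p.2).aestronglyMeasurable C
        (Eventually.of_forall fun ω => hC _ _)
  rw [(hsum.const_mul _).eLpNorm_eq_integral_rpow_norm two_ne_zero ENNReal.ofNat_ne_top]
  refine ENNReal.ofReal_le_ofReal ?_
  simp only [ENNReal.toReal_ofNat, Real.rpow_two, Real.norm_eq_abs, sq_abs, mul_pow]
  rw [← one_div, ← Real.sqrt_eq_rpow, integral_const_mul]
  refine Real.sqrt_le_sqrt ?_
  calc (√(n : ℝ) / (n * (n - 1))) ^ 2 *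
        ∫ ω, (∑ p ∈ (Finset.range n).offDiag, r (Z p.1 ω) (Z p.2 ω)) ^ 2 ∂P
      ≤ (√(n : ℝ) / (n * (n - 1))) ^ 2 * ((n * (n - 1)) * (2 * C ^ 2)) :=
        mul_le_mul_of_nonneg_left
          (integral_sq_sum_degenerate_le hZ hindep hident hr hsymm hC hdeg n) (sq_nonneg _)
    _ = 2 * C ^ 2 / ((n : ℝ) - 1) := by
        have h1 : (n : ℝ) ≠ 0 := by linarith
        have h2 : (n : ℝ) - 1 ≠ 0 := by linarith
        rw [div_pow, Real.sq_sqrt (by linarith)]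
        field_simp

/-- Covariance of two kernel evaluations that share one argument. -/
lemma covariance_kernel_eq_variance {Z : ℕ → Ω → E} (hZ : ∀ i, Measurable (Z i))
    (hindep : iIndepFun Z P) (hident : ∀ i, IdentDistrib (Z i) (Z 0) P P)
    {h : E → E → ℝ} (hh : Measurable (Function.uncurry h)) {C : ℝ} (hC : ∀ x y, |h x y| ≤ C) :
    covariance (fun ω => h (Z 0 ω) (Z 1 ω)) (fun ω => h (Z 0 ω) (Z 2 ω)) P =
      variance (fun ω => ∫ y, h (Z 0 ω) y ∂(P.map (Z 0))) P := by
  have := Measure.isProbabilityMeasure_map (μ := P) (hZ 0).aemeasurable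
  have hgm : Measurable fun x => ∫ y, h x y ∂(P.map (Z 0)) :=
    (hh.stronglyMeasurable.integral_prod_right).measurable
  have hgC : ∀ x, |∫ y, h x y ∂(P.map (Z 0))| ≤ C := fun x => by
    simpa using norm_integral_le_of_norm_le_const (μ := P.map (Z 0)) (f := h x)
      (Eventually.of_forall (hC x))
  have hLp : ∀ i j, MemLp (fun ω => h (Z i ω) (Z j ω)) 2 P := fun i j =>
    MemLp.of_bound (measurable_kernel_comp hZ hh _ _).aestronglyMeasurable C
      (Eventually.of_forall fun ω => hC _ _)
  have hgLp : MemLp (fun ω => ∫ y, h (Z 0 ω) y ∂(P.map (Z 0))) 2 P :=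
    MemLp.of_bound (hgm.comp (hZ 0)).aestronglyMeasurable C
      (Eventually.of_forall fun ω => hgC _)
  have hmean : ∀ j, 0 ≠ j → ∫ ω, h (Z 0 ω) (Z j ω) ∂P =
      ∫ ω, (∫ y, h (Z 0 ω) y ∂(P.map (Z 0))) ∂P := fun j hj => by
    have := integral_comp_prodMk_of_indepFun (hZ 0) (hZ j) (hindep.indepFun hj) hh
      (fun p => hC p.1 p.2)
    simpa [(hident j).map_eq] using this
  -- Integrating out `Z 2`, then `Z 1`, with `Z 0` held fixed, turns each factor into the
  -- projection.
  have h1 : ∫ ω, h (Z 0 ω) (Z 1 ω) * h (Z 0 ω) (Z 2 ω) ∂P =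
      ∫ ω, h (Z 0 ω) (Z 1 ω) * (∫ y, h (Z 0 ω) y ∂(P.map (Z 0))) ∂P := by
    have hm : Measurable fun p : (E × E) × E => h p.1.1 p.1.2 * h p.1.1 p.2 :=
      (hh.comp (g := Function.uncurry h) measurable_fst).mul
        (hh.comp (g := Function.uncurry h) (f := fun p : (E × E) × E => (p.1.1, p.2))
          (by fun_prop))
    have := integral_comp_prodMk_of_indepFun ((hZ 0).prodMk (hZ 1)) (hZ 2)
      (hindep.indepFun_prodMk hZ 0 1 2 (by simp) (by simp)) hm (C := C * C) (fun p => by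
        rw [abs_mul]
        exact mul_le_mul (hC _ _) (hC _ _) (abs_nonneg _) ((abs_nonneg _).trans (hC p.1.1 p.2)))
    simpa [(hident 2).map_eq, integral_const_mul] using this
  have h2 : ∫ ω, h (Z 0 ω) (Z 1 ω) * (∫ y, h (Z 0 ω) y ∂(P.map (Z 0))) ∂P =
      ∫ ω, (∫ y, h (Z 0 ω) y ∂(P.map (Z 0))) ^ 2 ∂P := by
    have hm : Measurable fun p : E × E => h p.1 p.2 * ∫ y, h p.1 y ∂(P.map (Z 0)) :=
      hh.mul (hgm.comp measurable_fst)
    have := integral_comp_prodMk_of_indepFun (hZ 0) (hZ 1)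
      (hindep.indepFun zero_ne_one) hm (C := C * C) (fun p => by
        rw [abs_mul]
        exact mul_le_mul (hC _ _) (hgC _) (abs_nonneg _) ((abs_nonneg _).trans (hC p.1 p.2)))
    simpa [(hident 1).map_eq, integral_mul_const, sq] using this
  rw [covariance_eq_sub (hLp 0 1) (hLp 0 2), variance_eq_sub hgLp]
  simp only [Pi.mul_apply, Pi.pow_apply]
  rw [h1, h2, hmean 1 (by simp), hmean 2 (by simp), sq (∫ ω, _ ∂P)]

/-- Each index lies in `2 (n - 1)` ordered off-diagonal pairs; this is the source of the `2` in the
linear part `2 g`. -/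
lemma sum_offDiag_add (n : ℕ) (a : ℕ → ℝ) :
    ∑ p ∈ (Finset.range n).offDiag, (a p.1 + a p.2) =
      2 * ((n : ℝ) - 1) * ∑ i ∈ Finset.range n, a i := by
  have h := Finset.sum_union (f := fun p : ℕ × ℕ => a p.1 + a p.2)
    (Finset.disjoint_diag_offDiag (Finset.range n))
  rw [Finset.diag_union_offDiag, Finset.sum_product, Finset.sum_diag] at h
  simp only [Finset.sum_add_distrib, Finset.sum_const, Finset.card_range, nsmul_eq_mul,
    ← Finset.mul_sum] at h ⊢
  linarith

/-- **Central limit theorem for U-statistics** of order two with a bounded symmetric kernel. -/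
theorem tendstoInDistribution_uStatistic {Z : ℕ → Ω → E} (hZ : ∀ i, Measurable (Z i))
    (hindep : iIndepFun Z P) (hident : ∀ i, IdentDistrib (Z i) (Z 0) P P)
    {h : E → E → ℝ} (hh : Measurable (Function.uncurry h)) (hsymm : ∀ x y, h x y = h y x)
    {C : ℝ} (hC : ∀ x y, |h x y| ≤ C) {v : ℝ≥0}
    (hv : (v : ℝ) = 4 * covariance (fun ω => h (Z 0 ω) (Z 1 ω)) (fun ω => h (Z 0 ω) (Z 2 ω)) P) :
    TendstoInDistribution (fun (n : ℕ) ω => √(n : ℝ) *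
        ((n * ((n : ℝ) - 1))⁻¹ * ∑ p ∈ (Finset.range n).offDiag, h (Z p.1 ω) (Z p.2 ω) -
          ∫ ω, h (Z 0 ω) (Z 1 ω) ∂P))
      atTop (id : ℝ → ℝ) (fun _ => P) (gaussianReal 0 v) := by
  have := Measure.isProbabilityMeasure_map (μ := P) (hZ 0).aemeasurable
  set θ := ∫ ω, h (Z 0 ω) (Z 1 ω) ∂P with hθ
  set g : E → ℝ := fun x => ∫ y, h x y ∂(P.map (Z 0)) with hg
  have hgm : Measurable g := (hh.stronglyMeasurable.integral_prod_right).measurable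
  have hgC : ∀ x, |g x| ≤ C := fun x => by
    simpa using norm_integral_le_of_norm_le_const (μ := P.map (Z 0)) (f := h x)
      (Eventually.of_forall (hC x))
  have hmean : ∫ ω, g (Z 0 ω) ∂P = θ := by
    have := integral_comp_prodMk_of_indepFun (hZ 0) (hZ 1) (hindep.indepFun zero_ne_one) hh
      (fun p => hC p.1 p.2)
    simpa [(hident 1).map_eq, hθ, hg] using this.symm
  have hθC : |θ| ≤ C := by
    simpa using norm_integral_le_of_norm_le_const (μ := P)
      (f := fun ω => h (Z 0 ω) (Z 1 ω)) (Eventually.of_forall fun ω => hC (Z 0 ω) (Z 1 ω))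
  -- The degenerate Hoeffding remainder.
  set r : E → E → ℝ := fun x y => h x y - g x - g y + θ with hr
  have hrm : Measurable (Function.uncurry r) :=
    ((hh.sub (hgm.comp measurable_fst)).sub (hgm.comp measurable_snd)).add_const θ
  have hrsymm : ∀ x y, r x y = r y x := fun x y => by
    simp only [hr, hsymm x y]
    ring
  have hrC : ∀ x y, |r x y| ≤ 4 * C := fun x y => by
    have h1 := abs_le.1 (hC x y)
    have h2 := abs_le.1 (hgC x)
    have h3 := abs_le.1 (hgC y)
    have h4 := abs_le.1 hθC
    exact abs_le.2 ⟨by simp only [hr]; linarith, by simp only [hr]; linarith⟩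
  have hgint : Integrable g (P.map (Z 0)) :=
    Integrable.of_bound hgm.aestronglyMeasurable C (Eventually.of_forall hgC)
  have hdeg : ∀ x, ∫ y, r x y ∂(P.map (Z 0)) = 0 := fun x => by
    have hhint : Integrable (h x) (P.map (Z 0)) :=
      Integrable.of_bound (hh.comp measurable_prodMk_left).aestronglyMeasurable C
        (Eventually.of_forall (hC x))
    have hgθ : ∫ y, g y ∂(P.map (Z 0)) = θ := by
      rw [integral_map (hZ 0).aemeasurable hgm.aestronglyMeasurable, hmean]
    simp only [hr]
    have h1 : Integrable (fun y => h x y - g x) (P.map (Z 0)) := hhint.sub (integrable_const _)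
    have h2 : Integrable (fun y => h x y - g x - g y) (P.map (Z 0)) := h1.sub hgint
    rw [integral_add h2 (integrable_const _), integral_sub h1 hgint,
      integral_sub hhint (integrable_const _), hgθ]
    simp [hg]
  have hgLp : MemLp (fun ω => g (Z 0 ω)) 2 P :=
    MemLp.of_bound (hgm.comp (hZ 0)).aestronglyMeasurable C (Eventually.of_forall fun ω => hgC _)
  have hvar : variance (fun ω => 2 * g (Z 0 ω)) P = v := by
    rw [variance_const_mul, hv, covariance_kernel_eq_variance hZ hindep hident hh hC]
    norm_num [hg]
  have hclt := tendstoInDistribution_inv_sqrt_mul_sum_sub (P := P) (P' := gaussianReal 0 v)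
    (X := fun i ω => 2 * g (Z i ω)) (Y := id)
    (by rw [hvar, Real.toNNReal_coe]; exact HasLaw.id) (hgLp.const_mul 2)
    (hindep.comp (fun _ x => 2 * g x) fun _ => hgm.const_mul 2)
    (fun i => (hident i).comp (u := fun x => 2 * g x) (hgm.const_mul 2))
  rw [integral_const_mul, hmean] at hclt
  have hYm : ∀ n : ℕ, Measurable fun ω => √(n : ℝ) *
      ((n * ((n : ℝ) - 1))⁻¹ * ∑ p ∈ (Finset.range n).offDiag, h (Z p.1 ω) (Z p.2 ω) - θ) :=
    fun n => (((Finset.measurable_fun_sum _ fun p _ =>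
      measurable_kernel_comp hZ hh _ _).const_mul _).sub_const _).const_mul _
  -- Slutsky: the difference from the linear part is the scaled sum of `r`, which tends to zero in
  -- `L²`, hence in measure.
  refine tendstoInDistribution_of_tendstoInMeasure_sub _ _ hclt ?_ fun n => (hYm n).aemeasurable
  refine tendstoInMeasure_of_tendsto_eLpNorm two_ne_zero
    (fun n => ((hYm n).aemeasurable.sub (hclt.forall_aemeasurable n)).aestronglyMeasurable)
    aestronglyMeasurable_const ?_
  refine (tendsto_eLpNorm_degenerate hZ hindep hident hrm hrsymm hrC hdeg).congr' ?_
  filter_upwards [eventually_ge_atTop 2] with n hn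
  have hn' : (2 : ℝ) ≤ n := by exact_mod_cast hn
  congr 1
  ext ω
  have hsum : ∑ p ∈ (Finset.range n).offDiag, r (Z p.1 ω) (Z p.2 ω) =
      ∑ p ∈ (Finset.range n).offDiag, h (Z p.1 ω) (Z p.2 ω) -
        2 * ((n : ℝ) - 1) * ∑ i ∈ Finset.range n, (g (Z i ω) - θ) - n * (n - 1) * θ := by
    rw [← sum_offDiag_add n fun i => g (Z i ω) - θ, ← card_offDiag_range, ← nsmul_eq_mul,
      ← Finset.sum_const, ← Finset.sum_sub_distrib, ← Finset.sum_sub_distrib]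
    exact Finset.sum_congr rfl fun p _ => by simp only [hr]; ring
  simp only [Pi.sub_apply, Pi.zero_apply, sub_zero]
  rw [hsum, Finset.sum_sub_distrib, ← Finset.mul_sum]
  simp only [Finset.sum_const, Finset.card_range, nsmul_eq_mul]
  have h1 : (n : ℝ) ≠ 0 := by linarith
  have h2 : (n : ℝ) - 1 ≠ 0 := by linarith
  have h3 : √(n : ℝ) ≠ 0 := Real.sqrt_ne_zero'.2 (by linarith)
  rw [← Real.sqrt_div_self]
  field_simp
  ring

end UStatistic

/-! ### The error rates as averages of kernels -/

namespace FaceVerification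

variable {d M : ℕ}

open Classical in
/-- The within-identity average as a function of the family of embeddings of one identity. -/
noncomputable def withinKernel (s : EuclideanSpace ℝ (Fin d) → EuclideanSpace ℝ (Fin d) → ℝ)
    (t : ℝ) (x : Fin M → EuclideanSpace ℝ (Fin d)) : ℝ :=
  ∑ k : Fin M, ∑ l ∈ Finset.univ.filter (fun l : Fin M => l ≠ k),
    (if t ≤ s (x k) (x l) then 1 else 0) / ((M : ℝ) * ((M : ℝ) - 1))

open Classical in
/-- The between-identity average as a function of the families of embeddings of two identities. -/
noncomputable def betweenKernel (s : EuclideanSpace ℝ (Fin d) → EuclideanSpace ℝ (Fin d) → ℝ)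
    (t : ℝ) (x y : Fin M → EuclideanSpace ℝ (Fin d)) : ℝ :=
  ∑ k : Fin M, ∑ l : Fin M, (if s (x k) (y l) < t then 1 else 0) / (M : ℝ) ^ 2

variable {s : EuclideanSpace ℝ (Fin d) → EuclideanSpace ℝ (Fin d) → ℝ} {t : ℝ}

lemma measurable_withinKernel (hs : Measurable (Function.uncurry s)) :
    Measurable (withinKernel (M := M) s t) := by
  refine Finset.measurable_fun_sum _ fun k _ => Finset.measurable_fun_sum _ fun l _ => ?_
  refine Measurable.div_const (Measurable.ite ?_ measurable_const measurable_const) _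
  exact measurableSet_le measurable_const
    (hs.comp (g := Function.uncurry s)
      (f := fun x : Fin M → EuclideanSpace ℝ (Fin d) => (x k, x l)) (by fun_prop))

lemma measurable_betweenKernel (hs : Measurable (Function.uncurry s)) :
    Measurable (Function.uncurry (betweenKernel (M := M) s t)) := by
  simp only [Function.uncurry_def, betweenKernel]
  refine Finset.measurable_fun_sum _ fun k _ => Finset.measurable_fun_sum _ fun l _ => ?_
  refine Measurable.div_const (Measurable.ite ?_ measurable_const measurable_const) _
  refine measurableSet_lt
    (hs.comp (g := Function.uncurry s)
      (f := fun p : (Fin M → EuclideanSpace ℝ (Fin d)) × (Fin M → EuclideanSpace ℝ (Fin d)) =>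
        (p.1 k, p.2 l)) (by fun_prop)) measurable_const

/-- The size of the bound is irrelevant; it only has to be independent of `x`. -/
lemma abs_withinKernel_le (x : Fin M → EuclideanSpace ℝ (Fin d)) :
    |withinKernel s t x| ≤ ∑ k : Fin M, ∑ _l ∈ Finset.univ.filter (fun l : Fin M => l ≠ k),
      1 / |(M : ℝ) * ((M : ℝ) - 1)| := by
  refine (Finset.abs_sum_le_sum_abs _ _).trans (Finset.sum_le_sum fun k _ => ?_)
  refine (Finset.abs_sum_le_sum_abs _ _).trans (Finset.sum_le_sum fun l _ => ?_)
  rw [abs_div]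
  gcongr
  split_ifs <;> simp

lemma abs_betweenKernel_le (x y : Fin M → EuclideanSpace ℝ (Fin d)) :
    |betweenKernel s t x y| ≤ ∑ _k : Fin M, ∑ _l : Fin M, 1 / |(M : ℝ) ^ 2| := by
  refine (Finset.abs_sum_le_sum_abs _ _).trans (Finset.sum_le_sum fun k _ => ?_)
  refine (Finset.abs_sum_le_sum_abs _ _).trans (Finset.sum_le_sum fun l _ => ?_)
  rw [abs_div]
  gcongr
  split_ifs <;> simp

lemma betweenKernel_symm (hs : ∀ x y, s x y = s y x)
    (x y : Fin M → EuclideanSpace ℝ (Fin d)) :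
    betweenKernel s t x y = betweenKernel s t y x := by
  unfold betweenKernel
  rw [Finset.sum_comm]
  simp_rw [hs (x _) (y _)]

variable {Ω : Type*} {X : ℕ → Fin M → Ω → EuclideanSpace ℝ (Fin d)}

lemma Ybar_self (i : ℕ) (ω : Ω) : Ybar s t X i i ω = withinKernel s t (fun k => X i k ω) := by
  simp [Ybar, withinKernel, Y]

lemma Ybar_of_ne {i j : ℕ} (hij : i ≠ j) (ω : Ω) :
    Ybar s t X i j ω = betweenKernel s t (fun k => X i k ω) (fun k => X j k ω) := by
  simp [Ybar, betweenKernel, Y, hij]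

lemma FARhat_eq (G : ℕ) (ω : Ω) :
    FARhat s t X G ω = (G * ((G : ℝ) - 1))⁻¹ * ∑ p ∈ (Finset.range G).offDiag,
      betweenKernel s t (fun k => X p.1 k ω) (fun k => X p.2 k ω) := by
  have h : (Finset.range G).offDiag =
      (Finset.range G ×ˢ Finset.range G).filter fun p => p.2 ≠ p.1 := by
    ext p
    simp [Finset.mem_offDiag, and_assoc, ne_comm]
  rw [h, Finset.sum_filter, Finset.sum_product, FARhat, Finset.mul_sum]
  refine Finset.sum_congr rfl fun i _ => ?_
  rw [← Finset.sum_filter, Finset.mul_sum]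
  refine Finset.sum_congr rfl fun j hj => ?_
  rw [Ybar_of_ne (Finset.mem_filter.1 hj).2.symm, div_eq_inv_mul]

lemma Y_eq_zero_or_one (i : ℕ) (k : Fin M) (j : ℕ) (l : Fin M) (ω : Ω) :
    Y s t X i k j l ω = 0 ∨ Y s t X i k j l ω = 1 := by
  unfold Y
  split_ifs <;> simp

/-! ### Unbiasedness of the identity-level averages -/

variable [MeasurableSpace Ω] {P : Measure Ω}

lemma measurable_Y (hs : Measurable (Function.uncurry s)) (hX : ∀ i k, Measurable (X i k))
    (i : ℕ) (k : Fin M) (j : ℕ) (l : Fin M) : Measurable (Y s t X i k j l) := by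
  have hm : Measurable fun ω => s (X i k ω) (X j l ω) := hs.comp ((hX i k).prodMk (hX j l))
  unfold Y
  split_ifs
  · exact Measurable.ite (measurableSet_le measurable_const hm) measurable_const measurable_const
  · exact Measurable.ite (measurableSet_lt hm measurable_const) measurable_const measurable_const

lemma integral_Y (hs : Measurable (Function.uncurry s)) (hX : ∀ i k, Measurable (X i k))
    (i : ℕ) (k : Fin M) (j : ℕ) (l : Fin M) :
    ∫ ω, Y s t X i k j l ω ∂P = P.real {ω | Y s t X i k j l ω = 1} := by
  have hm : MeasurableSet {ω | Y s t X i k j l ω = 1} :=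
    measurable_Y hs hX i k j l (measurableSet_singleton 1)
  rw [← integral_indicator_one hm]
  congr 1
  ext ω
  rcases Y_eq_zero_or_one (s := s) (t := t) (X := X) i k j l ω with h | h <;>
    simp [h]

variable [IsProbabilityMeasure P]

lemma integrable_Y (hs : Measurable (Function.uncurry s)) (hX : ∀ i k, Measurable (X i k))
    (i : ℕ) (k : Fin M) (j : ℕ) (l : Fin M) : Integrable (Y s t X i k j l) P :=
  Integrable.of_bound (measurable_Y hs hX i k j l).aestronglyMeasurable 1
    (Eventually.of_forall fun ω => by
      rcases Y_eq_zero_or_one (s := s) (t := t) (X := X) i k j l ω with h | h <;> simp [h])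

lemma integral_Ybar_self (hM : 2 ≤ M) (hs : Measurable (Function.uncurry s))
    (hX : ∀ i k, Measurable (X i k)) {FRR : ℝ} (i : ℕ)
    (hFRR : ∀ k l : Fin M, k ≠ l → P.real {ω | Y s t X i k i l ω = 1} = FRR) :
    ∫ ω, Ybar s t X i i ω ∂P = FRR := by
  have hM' : (2 : ℝ) ≤ M := by exact_mod_cast hM
  simp only [Ybar, if_true]
  rw [integral_finsetSum _ fun k _ => integrable_finsetSum _ fun l _ =>
    (integrable_Y hs hX i k i l).div_const _]
  have h : ∀ k : Fin M, ∫ ω, ∑ l ∈ Finset.univ.filter (fun l : Fin M => l ≠ k),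
      Y s t X i k i l ω / ((M : ℝ) * ((M : ℝ) - 1)) ∂P = FRR / M := fun k => by
    rw [integral_finsetSum _ fun l _ => (integrable_Y hs hX i k i l).div_const _]
    have hterm : ∀ l ∈ Finset.univ.filter (fun l : Fin M => l ≠ k),
        ∫ ω, Y s t X i k i l ω / ((M : ℝ) * ((M : ℝ) - 1)) ∂P =
          FRR / ((M : ℝ) * ((M : ℝ) - 1)) := fun l hl => by
      rw [integral_div, integral_Y hs hX, hFRR k l (Finset.mem_filter.1 hl).2.symm]
    have hcard : ((Finset.univ.filter (fun l : Fin M => l ≠ k)).card : ℝ) = M - 1 := by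
      rw [Finset.filter_ne', Finset.card_erase_of_mem (Finset.mem_univ k), Finset.card_univ,
        Fintype.card_fin, Nat.cast_sub (by omega), Nat.cast_one]
    rw [Finset.sum_congr rfl hterm, Finset.sum_const, nsmul_eq_mul, hcard]
    have : (M : ℝ) - 1 ≠ 0 := by linarith
    field_simp
  rw [Finset.sum_congr rfl fun k _ => h k]
  simp only [Finset.sum_const, Finset.card_univ, Fintype.card_fin, nsmul_eq_mul]
  have : (M : ℝ) ≠ 0 := by linarith
  field_simp

lemma integral_Ybar_of_ne (hM : 2 ≤ M) (hs : Measurable (Function.uncurry s))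
    (hX : ∀ i k, Measurable (X i k)) {FAR : ℝ} {i j : ℕ} (hij : i ≠ j)
    (hFAR : ∀ k l : Fin M, P.real {ω | Y s t X i k j l ω = 1} = FAR) :
    ∫ ω, Ybar s t X i j ω ∂P = FAR := by
  have hM' : (2 : ℝ) ≤ M := by exact_mod_cast hM
  simp only [Ybar, if_neg hij]
  rw [integral_finsetSum _ fun k _ => integrable_finsetSum _ fun l _ =>
    (integrable_Y hs hX i k j l).div_const _]
  simp_rw [integral_finsetSum _ fun l _ => (integrable_Y hs hX i _ j l).div_const _,
    integral_div, integral_Y hs hX, hFAR]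
  simp only [Finset.sum_const, Finset.card_univ, Fintype.card_fin, nsmul_eq_mul]
  have : (M : ℝ) ≠ 0 := by linarith
  field_simp

end FaceVerification

/-! ### The two limit theorems -/

open FaceVerification in
theorem proposition1
    {Ω : Type*} [MeasurableSpace Ω] (P : Measure Ω) [IsProbabilityMeasure P]
    (d M : ℕ) (hM : 2 ≤ M)
    -- a measurable, symmetric similarity function and a threshold
    (s : EuclideanSpace ℝ (Fin d) → EuclideanSpace ℝ (Fin d) → ℝ)
    (hs_meas : Measurable (Function.uncurry s)) (hs_symm : ∀ x y, s x y = s y x) (t : ℝ)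
    -- `X i k` is the embedding of instance `k` of identity `i`; all have the common law `Q`
    (Q : Measure (EuclideanSpace ℝ (Fin d)))
    (X : ℕ → Fin M → Ω → EuclideanSpace ℝ (Fin d))
    (hX_meas : ∀ i k, Measurable (X i k))
    (hX_law : ∀ i k, P.map (X i k) = Q)
    -- the families of embeddings of the different identities are independent copies of each other
    (hX_indep : iIndepFun (fun (i : ℕ) (ω : Ω) (k : Fin M) => X i k ω) P)
    (hX_ident : ∀ i : ℕ, IdentDistrib (fun (ω : Ω) (k : Fin M) => X i k ω)
      (fun (ω : Ω) (k : Fin M) => X 0 k ω) P P)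
    -- `FRR` and `FAR` are the parameters of the Bernoulli variables `Y`
    (FRR FAR : ℝ)
    (hFRR : ∀ (i : ℕ) (k l : Fin M), k ≠ l → P.real {ω | Y s t X i k i l ω = 1} = FRR)
    (hFAR : ∀ (i j : ℕ) (k l : Fin M), i ≠ j → P.real {ω | Y s t X i k j l ω = 1} = FAR)
    (cFRR cFAR : ℝ) (hcFRR : 0 < cFRR) (hcFAR : 0 < cFAR)
    (hvarFRR : Tendsto (fun G : ℕ => variance (fun ω => √(G : ℝ) * FRRhat s t X G ω) P)
      atTop (nhds cFRR))
    (hvarFAR : Tendsto (fun G : ℕ => variance (fun ω => √(G : ℝ) * FARhat s t X G ω) P)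
      atTop (nhds cFAR)) :
    (∃ v : ℝ≥0, (v : ℝ) = variance (Ybar s t X 0 0) P ∧
      TendstoInDistribution (fun (G : ℕ) (ω : Ω) => √(G : ℝ) * (FRRhat s t X G ω - FRR))
        atTop (id : ℝ → ℝ) (fun _ => P) (gaussianReal 0 v)) ∧
    (∃ v : ℝ≥0, (v : ℝ) = 4 * covariance (Ybar s t X 0 1) (Ybar s t X 0 2) P ∧
      TendstoInDistribution (fun (G : ℕ) (ω : Ω) => √(G : ℝ) * (FARhat s t X G ω - FAR))
        atTop (id : ℝ → ℝ) (fun _ => P) (gaussianReal 0 v)) := by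
  have hZ : ∀ i : ℕ, Measurable fun (ω : Ω) (k : Fin M) => X i k ω := fun i =>
    measurable_pi_lambda _ fun k => hX_meas i k
  constructor
  · have hm : Measurable (withinKernel (M := M) s t) := measurable_withinKernel hs_meas
    have hY : ∀ i, Ybar s t X i i = fun ω => withinKernel s t (fun k => X i k ω) := fun i =>
      funext fun ω => Ybar_self i ω
    refine ⟨(variance (Ybar s t X 0 0) P).toNNReal,
      Real.coe_toNNReal _ (variance_nonneg _ _), ?_⟩
    have hclt := tendstoInDistribution_inv_sqrt_mul_sum_sub (P := P)
      (X := fun i => Ybar s t X i i) (Y := id) HasLaw.id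
      (by
        simp only [hY]
        exact MemLp.of_bound (hm.comp (hZ 0)).aestronglyMeasurable _
          (Eventually.of_forall fun ω => abs_withinKernel_le _))
      (by
        simp only [hY]
        exact hX_indep.comp (fun _ => withinKernel s t) fun _ => hm)
      (fun i => by
        simp only [hY]
        exact (hX_ident i).comp hm)
    rw [integral_Ybar_self hM hs_meas hX_meas 0 (hFRR 0)] at hclt
    refine hclt.congr (fun G => Eventually.of_forall fun ω => ?_) EventuallyEq.rfl
    simp only [FRRhat, ← Finset.sum_div]
    -- The normalizations `(√G)⁻¹` and `√G / G` are matched by cancelling `G`; at `G = 0` both sides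
    -- vanish.
    rcases Nat.eq_zero_or_pos G with rfl | hG
    · simp
    · have hG' : (G : ℝ) ≠ 0 := by positivity
      rw [← Real.sqrt_div_self]
      field_simp
  · have hm := measurable_betweenKernel (M := M) (t := t) hs_meas
    have hY : ∀ {i j}, i ≠ j → Ybar s t X i j =
        fun ω => betweenKernel s t (fun k => X i k ω) (fun k => X j k ω) := fun hij =>
      funext fun ω => Ybar_of_ne hij ω
    have hcov := UStatistic.covariance_kernel_eq_variance hZ hX_indep hX_ident hm
      abs_betweenKernel_le
    -- This covariance is the variance of a projection, so it can serve as a Gaussian variance in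
    -- `ℝ≥0`.
    have hnonneg : 0 ≤ 4 * covariance (Ybar s t X 0 1) (Ybar s t X 0 2) P := by
      rw [hY (by simp), hY (by simp), hcov]
      exact mul_nonneg (by simp) (variance_nonneg _ _)
    refine ⟨⟨_, hnonneg⟩, rfl, ?_⟩
    have h := UStatistic.tendstoInDistribution_uStatistic hZ hX_indep hX_ident hm
      (betweenKernel_symm hs_symm) abs_betweenKernel_le (v := ⟨_, hnonneg⟩)
      (by rw [← hY (by simp), ← hY (by simp)]; rfl)
    simp_rw [← FARhat_eq, ← Ybar_of_ne (s := s) (t := t) (X := X) zero_ne_one,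
      integral_Ybar_of_ne hM hs_meas hX_meas zero_ne_one fun k l => hFAR 0 1 k l zero_ne_one] at h
    exact h
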